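/- Let $(S,\mathfrak n)$ be a Cohen–Macaulay local ring with $\dim S=d+1$ ($d\ge 1$), let $f\in\mathfrak n$ be a non-zero-divisor on $S$, and put $R=S/(f)$. Let $a_1,\dots,a_d,b\in\mathfrak n$ be a system of parameters of $S$ such that $$b^2+\sum_{i=1}^d a_ix_i=\varepsilon f$$ for some $x_1,\dots,x_d\in(a_1,\dots,a_d,b)$ and some unit $\varepsilon$ of $S$, and let $I=(\overline{a_1},\dots,\overline{a_d},\overline b)\subseteq R$. Let $K=(K_\bullet,\partial^K_\bullet)$ and $L=(K_\bullet,\partial^L_\bullet)$ be the Koszul complexes of $S$ on $a_1,\dots,a_d$ and on $x_1,\dots,x_d$, with differentials written as matrices in the standard bases $T_J=T_{j_1}\wedge\dots\wedge T_{j_p}$, $J=\{j_1<\dots<j_p\}\subseteq\{1,\dots,d\}$, where $\partial^K(T_J)=\sum_{\alpha}(-1)^{\alpha+1}a_{j_\alpha}T_{J\setminus\{j_\alpha\}}$, and likewise for $L$ with $x$ in place of $a$. Put $G_0=K_0$, $G_i=K_i\oplus G_{i-1}$ for $i\ge 1$, and define $\partial_i\colon G_i\to G_{i-1}$ by $$\partial_1=\left[\begin{array}{c|c}\partial^K_1&b\end{array}\right],\qquad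 \partial_2=\left[\begin{array}{c|c}\partial^K_2&-bE_d\mid{}^t\partial^L_1\\\hline O&\partial_1\end{array}\right],\qquad \partial_i=\left[\begin{array}{c|c}\partial^K_i&(-1)^{i-1}bE_{\binom d{i-1}}\mid{}^t\partial^L_{i-1}\mid O\\\hline O&\partial_{i-1}\end{array}\right]\quad(i\ge 3).$$ Since $K_{d+1}=0$, we have $G_{d+1}=G_d$, which is free of rank $2^d$, and $\partial_{d+1}$ is a square matrix. Let $F_i=G_i\otimes_S R$, $\overline{\partial_i}=\partial_i\otimes_S R$, $M=\operatorname{Im}\overline{\partial_d}\subseteq F_{d-1}$, and let $\tau\colon G_d\to F_d\xrightarrow{\overline{\partial_d}}M$ be the composite of the reduction modulo $f$ with $\overline{\partial_d}$. Then: 1. $\cdots\to F_2\xrightarrow{\overline{\partial_2}}F_1\xrightarrow{\overline{\partial_1}}F_0=R\to R/I\to0$ is a minimal free resolution of $R/I$; in particular $M$ is the $d$-th syzygy module of $R/I$. 2. The sequence $0\to G_{d+1}\xrightarrow{\partial_{d+1}}G_d\xrightarrow{\tau}M\to0$ is an exact sequence of $S$-modules. 3. $\partial_{d+1}^2=\varepsilon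 f\,E_{2^d}$. Consequently $\partial_{d+1}$ gives a matrix factorization of $M$: the pair $(\partial_{d+1},\partial_{d+1})$ is a matrix factorization of $\varepsilon f$ for $M$, and the pair $(\partial_{d+1},\varepsilon^{-1}\partial_{d+1})$ is a matrix factorization of $f$ for $M$. Here a matrix factorization of $g\in S$ for $M$ is a pair $(A,B)$ of $n\times n$ matrices over $S$ with $AB=BA=gE_n$ and an exact sequence $0\to S^n\xrightarrow{A}S^n\to M\to0$ of $S$-modules. -/

import Mathlib

noncomputable section

namespace UlrichMF

open IsLocalRing

/-- A Cohen-Macaulay local ring: a Noetherian local ring whose maximal ideal contains a regular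
sequence whose length is the Krull dimension of the ring (that is, depth = dimension). -/
structure IsCohenMacaulayLocal (S : Type*) [CommRing S] [IsLocalRing S] : Prop where
  noetherian : IsNoetherianRing S
  exists_regular : ∃ rs : List S, (∀ r ∈ rs, r ∈ maximalIdeal S) ∧
    RingTheory.Sequence.IsRegular S rs ∧ ringKrullDim S = rs.length

/-- `s 0, …, s (n - 1)` is a system of parameters of the local ring `S`: there are `dim S` of them,
they lie in the maximal ideal, and they generate an ideal primary to the maximal ideal. -/
structure IsSystemOfParameters {S : Type*} [CommRing S] [IsLocalRing S] {n : ℕ}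
    (s : Fin n → S) : Prop where
  dim_eq : ringKrullDim S = n
  mem : ∀ i, s i ∈ maximalIdeal S
  radical_eq : (Ideal.span (Set.range s)).radical = maximalIdeal S

/-- The sequence `a 0, …, a (d - 1), b`. -/
def params {S : Type*} {d : ℕ} (a : Fin d → S) (b : S) : Fin (d + 1) → S :=
  Fin.snoc (α := fun _ => S) a b

/-- The differential of the Koszul complex `K_•(a 0, …, a (d - 1); S)`, in all degrees at once, as a
matrix in the standard basis `T_I`, `I ⊆ Fin d`, where `T_I` has degree `#I`. If
`J = {j_1 < ⋯ < j_p}` and `I = J \ {j_α}`, the entry at `(I, J)` is `(-1)^(α - 1) * a j_α`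
(and `α - 1` is the number of elements of `J` below `j_α`); all other entries are `0`.
Its block from degree `p` to degree `p - 1` is the matrix `∂_p^K`. -/
def koszul {S : Type*} [CommRing S] {d : ℕ} (a : Fin d → S) :
    Matrix (Finset (Fin d)) (Finset (Fin d)) S :=
  fun I J => ∑ j ∈ J, if J.erase j = I then (-1) ^ (J.filter (· < j)).card * a j else 0

theorem koszul_eq_zero {S : Type*} [CommRing S] {d : ℕ} (a : Fin d → S) {I J : Finset (Fin d)}
    (h : J.card ≠ I.card + 1) : koszul a I J = 0 := by
  refine Finset.sum_eq_zero fun j hj => if_neg ?_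
  rintro rfl
  exact h (Finset.card_erase_add_one hj).symm

/-- The subsets of `Fin d` with fewer than `i` elements. They index the standard basis of
`G_{i-1} = K_{i-1} ⊕ K_{i-2} ⊕ ⋯ ⊕ K_0`; so `G_i` is `Idx d (i + 1) → S`. -/
abbrev Idx (d i : ℕ) : Type := {I : Finset (Fin d) // I.card < i}

/-- The matrix `∂_i : G_i → G_{i-1}`. With respect to
`G_i = K_i ⊕ ⋯ ⊕ K_0` and `G_{i-1} = K_{i-1} ⊕ ⋯ ⊕ K_0`, the block `K_q → K_p` is
`∂^K_{p+1}` if `q = p + 1`, `(-1)^p b E` if `q = p`, the transpose of `∂^L_p` if `q = p - 1`,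
and `0` otherwise, where `K` and `L` are the Koszul complexes of `a` and of `x`.
The lemmas below give its block decomposition. -/
def gdiff {S : Type*} [CommRing S] {d : ℕ} (a x : Fin d → S) (b : S) (i : ℕ) :
    Matrix (Idx d i) (Idx d (i + 1)) S :=
  fun I J => koszul a I.1 J.1 + (if I.1 = J.1 then (-1) ^ I.1.card * b else 0) + koszul x J.1 I.1

/-- The block `K_{i+1} → K_i` of `∂_{i+1}` is `∂^K_{i+1}`. -/
theorem gdiff_block_koszul {S : Type*} [CommRing S] {d : ℕ} (a x : Fin d → S) (b : S) (i : ℕ)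
    (I : Idx d (i + 1)) (J : Idx d (i + 2)) (hI : I.1.card = i) (hJ : J.1.card = i + 1) :
    gdiff a x b (i + 1) I J = koszul a I.1 J.1 := by
  have h1 : I.1 ≠ J.1 := fun h => by rw [h] at hI; omega
  simp [gdiff, h1, koszul_eq_zero x (I := J.1) (J := I.1) (by omega)]

/-- The block `K_i → K_i` of `∂_{i+1}` is `(-1)^i b E`. -/
theorem gdiff_block_scalar {S : Type*} [CommRing S] {d : ℕ} (a x : Fin d → S) (b : S) (i : ℕ)
    (I : Idx d (i + 1)) (J : Idx d (i + 2)) (hI : I.1.card = i) (hJ : J.1.card = i) :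
    gdiff a x b (i + 1) I J = if I.1 = J.1 then (-1) ^ i * b else 0 := by
  simp [gdiff, hI, koszul_eq_zero a (I := I.1) (J := J.1) (by omega),
    koszul_eq_zero x (I := J.1) (J := I.1) (by omega)]

/-- The block `K_{i-1} → K_i` of `∂_{i+1}` is the transpose of `∂^L_i`. -/
theorem gdiff_block_transpose {S : Type*} [CommRing S] {d : ℕ} (a x : Fin d → S) (b : S) (i : ℕ)
    (I : Idx d (i + 1)) (J : Idx d (i + 2)) (hI : I.1.card = i) (hJ : J.1.card + 1 = i) :
    gdiff a x b (i + 1) I J = koszul x J.1 I.1 := by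
  have h1 : I.1 ≠ J.1 := fun h => by rw [h] at hI; omega
  simp [gdiff, h1, koszul_eq_zero a (I := I.1) (J := J.1) (by omega)]

/-- The blocks `K_q → K_i` of `∂_{i+1}` with `q < i - 1` vanish. -/
theorem gdiff_block_zero {S : Type*} [CommRing S] {d : ℕ} (a x : Fin d → S) (b : S) (i : ℕ)
    (I : Idx d (i + 1)) (J : Idx d (i + 2)) (hI : I.1.card = i) (hJ : J.1.card + 1 < i) :
    gdiff a x b (i + 1) I J = 0 := by
  have h1 : I.1 ≠ J.1 := fun h => by rw [h] at hI; omega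
  simp [gdiff, h1, koszul_eq_zero a (I := I.1) (J := J.1) (by omega),
    koszul_eq_zero x (I := J.1) (J := I.1) (by omega)]

/-- The block `K_{i+1} → G_{i-1}` of `∂_{i+1}` vanishes. -/
theorem gdiff_lower_left {S : Type*} [CommRing S] {d : ℕ} (a x : Fin d → S) (b : S) (i : ℕ)
    (I : Idx d (i + 1)) (J : Idx d (i + 2)) (hI : I.1.card < i) (hJ : J.1.card = i + 1) :
    gdiff a x b (i + 1) I J = 0 := by
  have h1 : I.1 ≠ J.1 := fun h => by rw [h] at hI; omega
  simp [gdiff, h1, koszul_eq_zero a (I := I.1) (J := J.1) (by omega),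
    koszul_eq_zero x (I := J.1) (J := I.1) (by omega)]

/-- The block `G_i → G_{i-1}` of `∂_{i+1}` is `∂_i`. -/
theorem gdiff_lower_right {S : Type*} [CommRing S] {d : ℕ} (a x : Fin d → S) (b : S) (i : ℕ)
    (I : Idx d i) (J : Idx d (i + 1)) :
    gdiff a x b (i + 1) ⟨I.1, I.2.trans i.lt_succ_self⟩ ⟨J.1, J.2.trans (i + 1).lt_succ_self⟩ =
      gdiff a x b i I J := rfl

/-- The identification of the bases of `G_d` and of `G_{d+1}` (note `K_{d+1} = 0`). -/
def topEquiv (d : ℕ) : Idx d (d + 1) ≃ Idx d (d + 2) :=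
  Equiv.subtypeEquivRight fun I => by
    have h : I.card ≤ d := by simpa using Finset.card_le_univ I
    constructor <;> intro _ <;> omega

/-- `∂_{d+1} : G_{d+1} → G_d` as a square matrix, through `G_{d+1} = G_d`. -/
def topSquare {S : Type*} [CommRing S] {d : ℕ} (a x : Fin d → S) (b : S) :
    Matrix (Idx d (d + 1)) (Idx d (d + 1)) S :=
  (gdiff a x b (d + 1)).submatrix id (topEquiv d)

/-- The reduction `∂_i ⊗ R` of `∂_i` modulo `f`, where `R = S / (f)`. -/
def gdiffBar {S : Type*} [CommRing S] {d : ℕ} (f : S) (a x : Fin d → S) (b : S) (i : ℕ) :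
    Matrix (Idx d i) (Idx d (i + 1)) (S ⧸ Ideal.span {f}) :=
  (gdiff a x b i).map (Ideal.Quotient.mk (Ideal.span {f}))

/-- The ideal `I` of `R = S / (f)` generated by the images of `a 0, …, a (d - 1), b`. -/
def ulrichIdeal {S : Type*} [CommRing S] {d : ℕ} (f : S) (a : Fin d → S) (b : S) :
    Ideal (S ⧸ Ideal.span {f}) :=
  (Ideal.span (Set.range (params a b))).map (Ideal.Quotient.mk (Ideal.span {f}))

/-- The augmentation `F_0 = R → R / I`; the only basis element of `F_0` is `T_∅`. -/
def augmentation {R : Type*} [CommRing R] (d : ℕ) (I : Ideal R) :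
    (Idx d 1 → R) →ₗ[R] R ⧸ I :=
  I.mkQ ∘ₗ LinearMap.proj (⟨∅, by simp⟩ : Idx d 1)

/-- Let `R` be a local ring. `⋯ → F_2 → F_1 → F_0 → N → 0`, with `F_i` free on the finite set
`ι i`, with matrices `D i : F_{i+1} → F_i` and with augmentation `π : F_0 → N`, is a minimal free
resolution of `N`: it is exact and no entry of any `D i` is a unit of `R`. -/
structure IsMinimalFreeResolution {R : Type*} [CommRing R] {N : Type*} [AddCommGroup N]
    [Module R N] {ι : ℕ → Type*} [∀ i, Fintype (ι i)] (D : ∀ i, Matrix (ι i) (ι (i + 1)) R)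
    (π : (ι 0 → R) →ₗ[R] N) : Prop where
  surjective : Function.Surjective π
  exact_zero : Function.Exact (D 0).mulVecLin π
  exact_succ : ∀ i, Function.Exact (D (i + 1)).mulVecLin (D i).mulVecLin
  minimal : ∀ i k l, D i k l ∈ nonunits R

/-- `0 → A → B → C → 0` is exact. -/
structure IsShortExact {S A B C : Type*} [CommRing S] [AddCommGroup A] [AddCommGroup B]
    [AddCommGroup C] [Module S A] [Module S B] [Module S C] (u : A →ₗ[S] B) (v : B →ₗ[S] C) :
    Prop where
  injective : Function.Injective u
  exact : Function.Exact u v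
  surjective : Function.Surjective v

/-- The pair `(A, B)` of square matrices over `S` is a matrix factorization of `g` for the
`S`-module `M`: `AB = BA = gE`, and there is an exact sequence `0 → S^n → S^n → M → 0` whose first
map is `A`. -/
structure IsMatrixFactorization {S : Type*} [CommRing S] {n : Type*} [Fintype n] [DecidableEq n]
    (g : S) (A B : Matrix n n S) (M : Type*) [AddCommGroup M] [Module S M] : Prop where
  mul_eq : A * B = g • (1 : Matrix n n S)
  mul_eq' : B * A = g • (1 : Matrix n n S)
  exists_exact : ∃ π : (n → S) →ₗ[S] M, IsShortExact A.mulVecLin π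

/-- The `R`-module `M = Im (∂_d ⊗ R) ⊆ F_{d-1}`. -/
abbrev syzygyModule {S : Type*} [CommRing S] {d : ℕ} (f : S) (a x : Fin d → S) (b : S) :
    Submodule (S ⧸ Ideal.span {f}) (Idx d d → S ⧸ Ideal.span {f}) :=
  LinearMap.range (gdiffBar f a x b d).mulVecLin

/-- The composite `τ : G_d → F_d → M` of the reduction modulo `f` and of `∂_d ⊗ R`. -/
def tau {S : Type*} [CommRing S] {d : ℕ} (f : S) (a x : Fin d → S) (b : S) :
    (Idx d (d + 1) → S) →ₗ[S] syzygyModule f a x b :=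
  ((gdiffBar f a x b d).mulVecLin.rangeRestrict.restrictScalars S) ∘ₗ
    ((Algebra.linearMap S (S ⧸ Ideal.span {f})).compLeft (Idx d (d + 1)))

end UlrichMF

end

/-!
Put `D = ∂^K + (-1)^p b + ᵗ∂^L` on the whole exterior algebra `⨁ K_p`. Contraction against the
`a_i` and multiplication by the `x_i` satisfy the Clifford relations, so `D² = b² + ∑ a_i x_i = ε f`
(`totalDiff_mul_self`). Every `∂_i` is the submatrix of `D` on the degrees below `i` and `i + 1`, and
`D` lowers degrees by at most one, so that `∂_i ∂_{i+1}` is `ε f` followed by the projection, and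
`∂_{d+1} = D`. This gives the matrix factorization and makes `F` a complex.

`F` is the Shamash resolution of `R / I`: its `i`-th term is the sum of the terms of degrees
`i, i - 2, …` of the Koszul complex of `a, b`, and its exactness comes down to that of this Koszul
complex (`exists_totalDiff_boundary`). If `z ∈ G_{i+1}` satisfies `∂ z = ε f w`, then `D² = ε f`
forces `D w = z` in degrees below `i`, and subtracting `D w` from `z` leaves a chain in
`K_{i+1} ⊕ K_i` with boundary zero over `S`. Such a chain is a cycle of the Koszul complex of `a, b`,
seen as the cone of `b` on `K`; it bounds there, and hence also under `D`, as the further terms of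
`D` land above degree `i + 1`. So `z` is a boundary over `S`, which yields the exactness
of `F` and of `0 → G_{d+1} → G_d → M → 0`.

The Koszul complex of a system of parameters of a Cohen-Macaulay ring is exact in positive degrees
by depth sensitivity (`exists_smul_eq_of_isWeaklyRegular`): the ideal `(a, b)` acts null-homotopically
and its radical is the maximal ideal, which contains a regular sequence as long as the complex. It is
not needed that `a, b` itself is a regular sequence.
-/

namespace UlrichMF

open Finset Matrix

/-! ### Clifford relations between Koszul matrices -/

section Clifford

variable {S : Type*} [CommRing S] {d : ℕ}

/-- The sign `(-1)^m`, where `m` is the number of elements of `I` below `j`. -/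
def koszulSign (S : Type*) [CommRing S] {d : ℕ} (I : Finset (Fin d)) (j : Fin d) : S :=
  (-1) ^ (I.filter (· < j)).card

/-- The contraction against the `j`-th coordinate: it sends `T_J` to `± T_{J \ {j}}` if `j ∈ J` and
to `0` otherwise. -/
def contraction (S : Type*) [CommRing S] {d : ℕ} (j : Fin d) :
    Matrix (Finset (Fin d)) (Finset (Fin d)) S :=
  fun I J => if j ∉ I ∧ J = insert j I then koszulSign S I j else 0

theorem koszulSign_mul_self (I : Finset (Fin d)) (j : Fin d) :
    koszulSign S I j * koszulSign S I j = 1 := by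
  simp [koszulSign, ← mul_pow]

theorem koszulSign_insert {I : Finset (Fin d)} {i : Fin d} (h : i ∉ I) (j : Fin d) :
    koszulSign S (insert i I) j = koszulSign S I j * if i < j then -1 else 1 := by
  unfold koszulSign
  rw [filter_insert]
  split_ifs
  · rw [card_insert_of_notMem (by simp [h]), pow_succ]
  · simp

theorem koszulSign_erase {I : Finset (Fin d)} {i : Fin d} (h : i ∈ I) (j : Fin d) :
    koszulSign S (I.erase i) j = koszulSign S I j * if i < j then -1 else 1 := by
  have := koszulSign_insert (S := S) (notMem_erase i I) j
  rw [insert_erase h] at this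
  rw [this, mul_assoc]
  split_ifs <;> simp

theorem contraction_mul_apply (j : Fin d) (A : Matrix (Finset (Fin d)) (Finset (Fin d)) S)
    (I J : Finset (Fin d)) :
    (contraction S j * A) I J = if j ∉ I then koszulSign S I j * A (insert j I) J else 0 := by
  simp [Matrix.mul_apply, contraction, ite_and]

theorem transpose_contraction_mul_apply (j : Fin d)
    (A : Matrix (Finset (Fin d)) (Finset (Fin d)) S) (I J : Finset (Fin d)) :
    ((contraction S j)ᵀ * A) I J =
      if j ∈ I then koszulSign S (I.erase j) j * A (I.erase j) J else 0 := by
  have h : ∀ L : Finset (Fin d), (j ∉ L ∧ I = insert j L) ↔ (j ∈ I ∧ L = I.erase j) := by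
    intro L
    constructor
    · rintro ⟨h, rfl⟩
      simp [h]
    · rintro ⟨h, rfl⟩
      simp [h]
  simp [Matrix.mul_apply, contraction, h, ite_and]

theorem koszul_eq_sum (a : Fin d → S) : koszul a = ∑ j, a j • contraction S j := by
  ext I J
  simp only [koszul, Matrix.sum_apply, Matrix.smul_apply, contraction, smul_eq_mul]
  rw [← Finset.sum_subset (Finset.subset_univ J)]
  · refine Finset.sum_congr rfl fun j hj => ?_
    by_cases h : J.erase j = I
    · subst h
      have : (J.erase j).filter (· < j) = J.filter (· < j) := by
        ext k
        simp only [mem_filter, mem_erase]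
        exact ⟨fun h => ⟨h.1.2, h.2⟩, fun h => ⟨⟨h.2.ne, h.1⟩, h.2⟩⟩
      simp [hj, koszulSign, this, mul_comm]
    · rw [if_neg h, if_neg, mul_zero]
      rintro ⟨h1, rfl⟩
      exact h (erase_insert h1)
  · intro j _ hj
    rw [if_neg, mul_zero]
    rintro ⟨-, rfl⟩
    simp at hj

theorem ite_lt_add_ite_lt {i j : Fin d} (h : i ≠ j) :
    (if i < j then (-1 : S) else 1) + (if j < i then -1 else 1) = 0 := by
  rcases lt_or_gt_of_ne h with h | h <;> simp [h, h.not_gt]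

theorem contraction_anticomm (i j : Fin d) :
    contraction S i * contraction S j + contraction S j * contraction S i = 0 := by
  ext I J
  rw [Matrix.add_apply, contraction_mul_apply, contraction_mul_apply]
  simp only [contraction, Matrix.zero_apply]
  by_cases hij : i = j
  · subst hij; simp
  by_cases hi : i ∈ I
  · simp [hi]
  by_cases hj : j ∈ I
  · simp [hj]
  by_cases hJ : J = insert i (insert j I)
  · have hJ' : J = insert j (insert i I) := by rw [hJ, Finset.insert_comm]
    have e1 := koszulSign_insert (S := S) hi j
    have e2 := koszulSign_insert (S := S) hj i
    have h1 : i ∉ insert j I := by simp [hij, hi]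
    have h2 : j ∉ insert i I := by simp [Ne.symm hij, hj]
    rw [if_pos hi, if_pos hj, if_pos ⟨h2, hJ'⟩, if_pos ⟨h1, hJ⟩, e1, e2]
    linear_combination (koszulSign S I i * koszulSign S I j) * ite_lt_add_ite_lt (S := S) hij
  · have hJ' : J ≠ insert j (insert i I) := by rwa [Finset.insert_comm]
    simp [hJ, hJ']

theorem contraction_mul_transpose_add (i j : Fin d) :
    contraction S i * (contraction S j)ᵀ + (contraction S j)ᵀ * contraction S i =
      if i = j then 1 else 0 := by
  ext I J
  rw [Matrix.add_apply, contraction_mul_apply, transpose_contraction_mul_apply]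
  simp only [contraction, Matrix.transpose_apply]
  by_cases hij : i = j
  · subst hij
    rw [if_pos rfl, Matrix.one_apply]
    by_cases hi : i ∈ I
    · by_cases hJ : I = J
      · simp [hJ, koszulSign_mul_self, hJ ▸ hi]
      · simp [hi, hJ, Ne.symm hJ]
    · by_cases hJ : I = J
      · simp [hJ, koszulSign_mul_self, hJ ▸ hi]
      · have : ¬ (i ∉ J ∧ insert i I = insert i J) := by
          rintro ⟨h1, h2⟩
          apply hJ
          rw [← erase_insert hi, h2, erase_insert h1]
        simp [hi, hJ, this]
  · rw [if_neg hij, Matrix.zero_apply]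
    by_cases hi : i ∈ I
    · simp [hi, hij]
    by_cases hj : j ∈ I
    · by_cases hJ : J = insert i (I.erase j)
      · have h1 : j ∉ J ∧ insert i I = insert j J := by
          subst hJ
          refine ⟨by simp [Ne.symm hij], ?_⟩
          rw [Finset.insert_comm, insert_erase hj]
        have h2 : i ∉ I.erase j := by simp [hi]
        have e3 : koszulSign S J j = koszulSign S (I.erase j) j * if i < j then -1 else 1 := by
          rw [hJ, koszulSign_insert h2]
        rw [if_pos hi, if_pos h1, if_pos hj, if_pos ⟨h2, hJ⟩, e3, koszulSign_erase hj i]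
        linear_combination (koszulSign S I i * koszulSign S (I.erase j) j) *
          ite_lt_add_ite_lt (S := S) hij
      · have h1 : ¬ (j ∉ J ∧ insert i I = insert j J) := by
          rintro ⟨h1, h2⟩
          apply hJ
          rw [← erase_insert h1, ← h2, erase_insert_of_ne hij]
        simp [hj, hJ, h1]
    · have h1 : insert i I ≠ insert j J := by
        intro h
        have : j ∈ insert i I := h ▸ mem_insert_self j J
        simp [hj, Ne.symm hij] at this
      simp [hj, h1]

theorem koszul_mul_self (a : Fin d → S) : koszul a * koszul a = 0 := by
  have hsq : ∀ j : Fin d, contraction S j * contraction S j = 0 := by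
    intro j
    ext I J
    rw [contraction_mul_apply]
    simp [contraction]
  -- group the terms `(i, j)` and `(j, i)`, as `2` need not be invertible
  suffices H : ∀ s : Finset (Fin d), (∑ i ∈ s, a i • contraction S i) *
      (∑ j ∈ s, a j • contraction S j) = 0 by
    rw [koszul_eq_sum]; exact H univ
  intro s
  induction s using Finset.induction_on with
  | empty => simp
  | insert i s hi ih =>
    rw [sum_insert hi, add_mul, mul_add, mul_add, ih, smul_mul_smul_comm, hsq, smul_zero, zero_add,
      add_zero, mul_sum, sum_mul, ← sum_add_distrib]
    refine sum_eq_zero fun j _ => ?_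
    rw [smul_mul_smul_comm, smul_mul_smul_comm, mul_comm (a j), ← smul_add, contraction_anticomm,
      smul_zero]

/-- Wedging with `∑ x_i T_i` is a homotopy on the Koszul complex of `a` between `0` and
multiplication by `∑ a_i x_i`. -/
theorem koszul_mul_transpose_add (a x : Fin d → S) :
    koszul a * (koszul x)ᵀ + (koszul x)ᵀ * koszul a = (∑ i, a i * x i) • 1 := by
  simp only [koszul_eq_sum, Matrix.transpose_sum, Matrix.transpose_smul, sum_mul, mul_sum,
    smul_mul_smul_comm]
  rw [Finset.sum_comm (γ := Fin d), ← sum_add_distrib, Finset.sum_smul]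
  refine sum_congr rfl fun i _ => ?_
  rw [← sum_add_distrib]
  simp only [mul_comm (x _) (a _), ← smul_add, contraction_mul_transpose_add]
  simp

/-- The diagonal matrix which is multiplication by `(-1)^p b` on `K_p`. -/
def signDiag (d : ℕ) (b : S) : Matrix (Finset (Fin d)) (Finset (Fin d)) S :=
  diagonal fun I => (-1) ^ I.card * b

theorem signDiag_mul_signDiag (b c : S) : signDiag d b * signDiag d c = (b * c) • 1 := by
  rw [signDiag, signDiag, diagonal_mul_diagonal, smul_one_eq_diagonal]
  congr 1
  ext I
  rw [mul_mul_mul_comm, ← mul_pow]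
  simp

theorem signDiag_anticomm (a : Fin d → S) (b : S) :
    koszul a * signDiag d b + signDiag d b * koszul a = 0 := by
  ext I J
  rw [Matrix.add_apply, signDiag, mul_diagonal, diagonal_mul, Matrix.zero_apply]
  by_cases h : J.card = I.card + 1
  · rw [h]; ring
  · rw [koszul_eq_zero a h]; ring

theorem signDiag_anticomm_transpose (a : Fin d → S) (b : S) :
    (koszul a)ᵀ * signDiag d b + signDiag d b * (koszul a)ᵀ = 0 := by
  have := congrArg transpose (signDiag_anticomm a b)
  rw [transpose_add, transpose_mul, transpose_mul, signDiag, diagonal_transpose, transpose_zero,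
    add_comm] at this
  exact this

/-- The matrix `∂` on `⨁ K_p`, of which all `∂_i` are submatrices. -/
def totalDiff (a x : Fin d → S) (b : S) : Matrix (Finset (Fin d)) (Finset (Fin d)) S :=
  koszul a + signDiag d b + (koszul x)ᵀ

theorem totalDiff_mul_self (a x : Fin d → S) (b : S) :
    totalDiff a x b * totalDiff a x b = (b ^ 2 + ∑ i, a i * x i) • 1 := by
  have h1 := koszul_mul_self a
  have h2 : (koszul x)ᵀ * (koszul x)ᵀ = 0 := by
    rw [← transpose_mul, koszul_mul_self, transpose_zero]
  have h3 := koszul_mul_transpose_add a x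
  have h4 := signDiag_anticomm a b
  have h5 := signDiag_anticomm_transpose x b
  have h6 := signDiag_mul_signDiag (d := d) b b
  have key : totalDiff a x b * totalDiff a x b = koszul a * koszul a +
      (koszul x)ᵀ * (koszul x)ᵀ + (koszul a * signDiag d b + signDiag d b * koszul a) +
      ((koszul x)ᵀ * signDiag d b + signDiag d b * (koszul x)ᵀ) + signDiag d b * signDiag d b +
      (koszul a * (koszul x)ᵀ + (koszul x)ᵀ * koszul a) := by
    unfold totalDiff
    noncomm_ring
  rw [key, h1, h2, h3, h4, h5, h6, pow_two, add_smul]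
  simp

theorem gdiff_apply (a x : Fin d → S) (b : S) (i : ℕ) (I : Idx d i) (J : Idx d (i + 1)) :
    gdiff a x b i I J = totalDiff a x b I.1 J.1 := by
  simp [gdiff, totalDiff, signDiag, diagonal_apply]

end Clifford

/-! ### Depth sensitivity of a graded complex with null-homotopies -/

section Depth

open scoped Matrix.Module Pointwise

variable {S : Type*} [CommRing S] {P : Type*} [Fintype P] [DecidableEq P]

/-- A boundary concentrated in degree `i` is the boundary of an element concentrated in degree
`i + 1`. -/
theorem exists_homogeneous_of_smul_eq {M : Type*} [AddCommGroup M] [Module S M] {deg : P → ℕ}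
    {Δ : Matrix P P S} (hdeg : ∀ p q, deg q ≠ deg p + 1 → Δ p q = 0) {i : ℕ} {z u : P → M}
    (hz : ∀ p, deg p ≠ i → z p = 0) (hu : Δ • u = z) :
    ∃ v : P → M, (∀ p, deg p ≠ i + 1 → v p = 0) ∧ Δ • v = z := by
  refine ⟨fun p => if deg p = i + 1 then u p else 0, fun p hp => if_neg hp, ?_⟩
  funext p
  rw [Matrix.Module.smul_apply]
  by_cases hp : deg p = i
  · rw [← hu, Matrix.Module.smul_apply]
    refine sum_congr rfl fun q _ => ?_
    by_cases hq : deg q = i + 1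
    · rw [if_pos hq]
    · rw [hdeg p q (by omega), zero_smul, zero_smul]
  · rw [hz p hp]
    refine sum_eq_zero fun q _ => ?_
    by_cases hq : deg q = i + 1
    · rw [hdeg p q (by omega), zero_smul]
    · rw [if_neg hq, smul_zero]

/-- Let `Δ` be the differential of a complex of free modules in degrees at most `N`, and let every
element of an ideal `𝔞` act on it null-homotopically. If the radical of `𝔞` contains a weakly
`M`-regular sequence of length `r`, then the complex with coefficients in `M` is exact in all
degrees above `N - r`.

By induction on `r`: if `y` is the first member of the sequence, then exactness for `M / yM` in
degree `i + 1` makes `y` injective on the homology in degree `i`, and a power of `y` kills it. -/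
theorem exists_smul_eq_of_isWeaklyRegular {deg : P → ℕ} {N : ℕ} {Δ : Matrix P P S}
    (hΔ : Δ * Δ = 0) (hN : ∀ p, deg p ≤ N) (hdeg : ∀ p q, deg q ≠ deg p + 1 → Δ p q = 0)
    {𝔞 : Ideal S}
    (h𝔞 : ∀ y ∈ 𝔞, ∃ σ : Matrix P P S, Δ * σ + σ * Δ = y • 1) (rs : List S) :
    ∀ {M : Type*} [AddCommGroup M] [Module S M], RingTheory.Sequence.IsWeaklyRegular M rs →
      (∀ r ∈ rs, r ∈ 𝔞.radical) → ∀ {i : ℕ}, N < i + rs.length → ∀ {z : P → M},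
      (∀ p, deg p ≠ i → z p = 0) → Δ • z = 0 →
      ∃ u : P → M, (∀ p, deg p ≠ i + 1 → u p = 0) ∧ Δ • u = z := by
  induction rs with
  | nil =>
    intro M _ _ _ _ i hi z hz _
    refine ⟨0, fun _ _ => rfl, ?_⟩
    rw [smul_zero]
    funext p
    refine (hz p fun h => ?_).symm
    have := hN p
    simp at hi
    omega
  | cons y rs ih =>
    intro M _ _ hreg hrad i hi z hz hcyc
    rw [RingTheory.Sequence.isWeaklyRegular_cons_iff] at hreg
    obtain ⟨hy, hreg'⟩ := hreg
    have hcomm : ∀ (c : S) (v : P → M), Δ • (c • v) = c • (Δ • v) := by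
      intro c v
      funext p
      simp [Finset.smul_sum, smul_comm c]
    -- `y` is injective on homology in degree `i`: if `Δ w = y z'`, then `w` is a cycle modulo `y`,
    -- hence `w = Δ u + y t`, and so `Δ t = z'`
    have hinj : ∀ z' : P → M, (∀ p, deg p ≠ i → z' p = 0) → (∃ w : P → M, Δ • w = y • z') →
        ∃ u : P → M, Δ • u = z' := by
      rintro z' hz' ⟨w₀, hw₀⟩
      obtain ⟨w, hw, hwz⟩ := exists_homogeneous_of_smul_eq hdeg
        (z := y • z') (fun p hp => by simp [hz' p hp]) hw₀
      let π := (Submodule.mkQ (y • (⊤ : Submodule S M))).mapMatrixModule P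
      have hπ : ∀ v : P → M, π (y • v) = 0 := by
        intro v
        funext p
        change Submodule.Quotient.mk (y • v p) = _
        rw [Pi.zero_apply, Submodule.Quotient.mk_eq_zero]
        exact Submodule.smul_mem_pointwise_smul _ _ _ trivial
      obtain ⟨u₀, -, hu₀⟩ := ih hreg' (fun r hr => hrad r (List.mem_cons_of_mem _ hr))
        (i := i + 1) (by simp at hi; omega) (z := π w)
        (fun p hp => by change Submodule.mkQ _ (w p) = 0; rw [hw p hp, map_zero])
        (by rw [← map_smul, hwz, hπ])
      choose u hu using fun p => Submodule.mkQ_surjective _ (u₀ p)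
      have h1 : ∀ p, ∃ t : M, y • t = w p - (Δ • u) p := by
        intro p
        have h2 : π (Δ • u) = π w := by
          rw [map_smul, ← hu₀]
          congr 1
          funext q
          exact hu q
        have h3 := congrFun h2.symm p
        have h4 := (Submodule.Quotient.eq _).1 h3
        obtain ⟨t, -, ht⟩ := (Submodule.mem_smul_pointwise_iff_exists _ _ _).1 h4
        exact ⟨t, ht⟩
      choose t ht using h1
      refine ⟨t, ?_⟩
      have h5 : y • t = w - Δ • u := funext ht
      have h6 : y • (Δ • t) = y • z' - Δ • Δ • u := by
        rw [← hcomm, h5, smul_sub, hwz]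
      rw [← mul_smul Δ Δ u, hΔ, zero_smul, sub_zero] at h6
      exact funext fun p => hy (congrFun h6 p)
    -- a power of `y` kills homology
    obtain ⟨k, hk⟩ := hrad y List.mem_cons_self
    obtain ⟨σ, hσ⟩ := h𝔞 _ hk
    have hkz : ∃ w : P → M, Δ • w = y ^ k • z := by
      refine ⟨σ • z, ?_⟩
      have := congrArg (· • z) hσ
      simp only [add_smul, mul_smul, hcyc, smul_zero, add_zero] at this
      rw [this]
      funext p
      simp [Matrix.one_apply, ite_smul]
    have hbound : ∀ m : ℕ, (∃ w : P → M, Δ • w = y ^ m • z) → ∃ u : P → M, Δ • u = z := by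
      intro m
      induction m with
      | zero => simp
      | succ m ihm =>
        rintro ⟨w, hw⟩
        refine ihm (hinj _ (fun p hp => by simp [hz p hp]) ⟨w, ?_⟩)
        rw [hw, pow_succ', mul_smul]
    obtain ⟨u, hu⟩ := hbound k hkz
    exact exists_homogeneous_of_smul_eq hdeg hz hu

end Depth

/-! ### The Koszul complex of `a, b` as a cone -/

section Cone

open scoped Matrix.Module

variable {S : Type*} [CommRing S] {d : ℕ}

/-- The Koszul complex of `a 0, …, a (d - 1), b`, as the cone `K_p ⊕ K_{p-1}` of multiplication by
`b` on `K = K_•(a)`. -/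
def koszulCone (a : Fin d → S) (b : S) :
    Matrix (Finset (Fin d) ⊕ Finset (Fin d)) (Finset (Fin d) ⊕ Finset (Fin d)) S :=
  fromBlocks (koszul a) (signDiag d b) 0 (koszul a)

/-- The degree of a basis element of `koszulCone`. -/
def coneDeg : Finset (Fin d) ⊕ Finset (Fin d) → ℕ :=
  Sum.elim card fun I => I.card + 1

theorem koszulCone_mul_self (a : Fin d → S) (b : S) : koszulCone a b * koszulCone a b = 0 := by
  rw [koszulCone, fromBlocks_multiply]
  simp [koszul_mul_self, signDiag_anticomm]

theorem koszulCone_eq_zero (a : Fin d → S) (b : S) (p q : Finset (Fin d) ⊕ Finset (Fin d))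
    (h : coneDeg q ≠ coneDeg p + 1) : koszulCone a b p q = 0 := by
  rcases p with I | I <;> rcases q with J | J <;> simp [coneDeg] at h
  · exact koszul_eq_zero a h
  · have hIJ : I ≠ J := by
      rintro rfl
      exact h rfl
    simp [koszulCone, signDiag, hIJ]
  · rfl
  · exact koszul_eq_zero a h

theorem span_range_params (a : Fin d → S) (b : S) :
    Ideal.span (Set.range (params a b)) = Ideal.span (Set.range a) ⊔ Ideal.span {b} := by
  rw [← Ideal.span_union]
  congr 1
  rw [params, Fin.range_snoc, Set.insert_eq, Set.union_comm]

/-- Every element of `(a, b)` acts null-homotopically on the Koszul complex of `a, b`. -/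
theorem exists_homotopy_koszulCone (a : Fin d → S) (b : S) {y : S}
    (hy : y ∈ Ideal.span (Set.range (params a b))) :
    ∃ σ, koszulCone a b * σ + σ * koszulCone a b = y • 1 := by
  rw [span_range_params] at hy
  obtain ⟨s, hs, t, ht, rfl⟩ := Submodule.mem_sup.1 hy
  obtain ⟨x, rfl⟩ := (Ideal.mem_span_range_iff_exists_fun).1 hs
  obtain ⟨c, rfl⟩ := Ideal.mem_span_singleton'.1 ht
  refine ⟨fromBlocks (koszul x)ᵀ 0 (signDiag d c) (koszul x)ᵀ, ?_⟩
  have h1 := koszul_mul_transpose_add a x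
  have h2 := signDiag_anticomm_transpose x b
  have h3 := signDiag_anticomm a c
  have h4 := signDiag_mul_signDiag (d := d) b c
  have h5 := signDiag_mul_signDiag (d := d) c b
  simp only [mul_comm (x _)]
  rw [koszulCone, fromBlocks_multiply, fromBlocks_multiply, fromBlocks_add, ← fromBlocks_one,
    fromBlocks_smul, add_smul, ← h1, smul_zero]
  congr 1
  · rw [h4, mul_comm c b]; simp; abel
  · simpa [add_comm] using h2
  · simpa [add_comm] using h3
  · rw [h5]; simp; abel

/-- In a Cohen-Macaulay local ring, the Koszul complex of a system of parameters is exact in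
positive degrees; here spelled out for the cone over `K_•(a)`. -/
theorem exists_koszul_cone_boundary [IsLocalRing S] (hS : IsCohenMacaulayLocal S)
    (hdim : ringKrullDim S = d + 1) {a : Fin d → S} {b : S}
    (hab : IsSystemOfParameters (params a b)) {i : ℕ} {z₁ z₀ : Finset (Fin d) → S}
    (hz₁ : ∀ I, I.card ≠ i + 1 → z₁ I = 0) (hz₀ : ∀ I, I.card ≠ i → z₀ I = 0)
    (h₁ : koszul a *ᵥ z₁ + signDiag d b *ᵥ z₀ = 0) (h₀ : koszul a *ᵥ z₀ = 0) :
    ∃ u₁ u₀ : Finset (Fin d) → S, (∀ I, I.card ≠ i + 2 → u₁ I = 0) ∧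
      (∀ I, I.card ≠ i + 1 → u₀ I = 0) ∧ koszul a *ᵥ u₁ + signDiag d b *ᵥ u₀ = z₁ ∧
      koszul a *ᵥ u₀ = z₀ := by
  obtain ⟨rs, hrs, hreg, hlen⟩ := hS.exists_regular
  have hlen' : rs.length = d + 1 := by
    rw [hdim] at hlen
    exact_mod_cast hlen.symm
  have happ : ∀ v : Finset (Fin d) ⊕ Finset (Fin d) → S,
      koszulCone a b • v = koszulCone a b *ᵥ v := fun v => rfl
  obtain ⟨u, hu, huz⟩ := exists_smul_eq_of_isWeaklyRegular (deg := coneDeg) (N := d + 1)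
    (koszulCone_mul_self a b)
    (by
      rintro (I | I) <;> have := card_le_univ I <;> simp [coneDeg] at this ⊢ <;> omega)
    (koszulCone_eq_zero a b) (fun y hy => exists_homotopy_koszulCone a b hy) rs
    hreg.toIsWeaklyRegular (fun r hr => by rw [hab.radical_eq]; exact hrs r hr) (i := i + 1)
    (by omega) (z := Sum.elim z₁ z₀)
    (by
      rintro (I | I) h
      · exact hz₁ I h
      · exact hz₀ I (by simpa [coneDeg] using h))
    (by
      rw [happ, koszulCone, fromBlocks_mulVec]
      simp [h₁, h₀])
  rw [happ, koszulCone, fromBlocks_mulVec] at huz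
  refine ⟨u ∘ Sum.inl, u ∘ Sum.inr, fun I h => hu (Sum.inl I) h,
    fun I h => hu (Sum.inr I) (by simpa [coneDeg] using h), ?_, ?_⟩
  · funext I
    simpa using congrFun huz (Sum.inl I)
  · funext I
    simpa using congrFun huz (Sum.inr I)

end Cone

/-! ### Exactness modulo `f` of the total differential -/

section Shamash

variable {S : Type*} [CommRing S] {d : ℕ}

theorem koszul_mulVec_eq_zero (a : Fin d → S) {u : Finset (Fin d) → S} {I : Finset (Fin d)}
    (h : ∀ J : Finset (Fin d), J.card = I.card + 1 → u J = 0) : (koszul a *ᵥ u) I = 0 := by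
  rw [mulVec, dotProduct]
  refine sum_eq_zero fun J _ => ?_
  by_cases hJ : J.card = I.card + 1
  · rw [h J hJ, mul_zero]
  · rw [koszul_eq_zero a hJ, zero_mul]

theorem transpose_koszul_mulVec_eq_zero (x : Fin d → S) {u : Finset (Fin d) → S}
    {I : Finset (Fin d)} (h : ∀ J : Finset (Fin d), J.card + 1 = I.card → u J = 0) :
    ((koszul x)ᵀ *ᵥ u) I = 0 := by
  rw [mulVec, dotProduct]
  refine sum_eq_zero fun J _ => ?_
  by_cases hJ : J.card + 1 = I.card
  · rw [h J hJ, mul_zero]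
  · rw [transpose_apply, koszul_eq_zero x (Ne.symm hJ), zero_mul]

theorem signDiag_mulVec (b : S) (u : Finset (Fin d) → S) (I : Finset (Fin d)) :
    (signDiag d b *ᵥ u) I = (-1) ^ I.card * b * u I := by
  rw [signDiag, mulVec_diagonal]

theorem totalDiff_eq_zero (a x : Fin d → S) (b : S) {I J : Finset (Fin d)}
    (h : I.card + 1 < J.card) : totalDiff a x b I J = 0 := by
  have h1 : I ≠ J := by rintro rfl; omega
  simp [totalDiff, signDiag, h1, koszul_eq_zero a (I := I) (J := J) (by omega),
    koszul_eq_zero x (I := J) (J := I) (by omega)]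

theorem totalDiff_mulVec_congr (a x : Fin d → S) (b : S) {u v : Finset (Fin d) → S}
    {I : Finset (Fin d)} (h : ∀ J : Finset (Fin d), J.card ≤ I.card + 1 → u J = v J) :
    (totalDiff a x b *ᵥ u) I = (totalDiff a x b *ᵥ v) I := by
  rw [mulVec, mulVec, dotProduct, dotProduct]
  refine sum_congr rfl fun J _ => ?_
  by_cases hJ : J.card ≤ I.card + 1
  · rw [h J hJ]
  · rw [totalDiff_eq_zero a x b (by omega), zero_mul, zero_mul]

theorem totalDiff_mulVec_mulVec (a x : Fin d → S) (b : S) {g : S}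
    (hg : b ^ 2 + ∑ i, a i * x i = g) (u : Finset (Fin d) → S) :
    totalDiff a x b *ᵥ totalDiff a x b *ᵥ u = g • u := by
  rw [mulVec_mulVec, totalDiff_mul_self, hg, smul_mulVec, one_mulVec]

/-- A chain of `G_{i+1}` which is a cycle modulo `g` is a boundary modulo `g`.

If `∂ z = g w`, then `∂² = g` forces `∂ w = z` in degrees below `i`. So `z - ∂ w` is concentrated in
`K_{i+1} ⊕ K_i`, where it is a cycle, over `S` itself, of the Koszul complex of `a, b`. -/
theorem exists_totalDiff_boundary [IsLocalRing S] (hS : IsCohenMacaulayLocal S)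
    (hdim : ringKrullDim S = d + 1) {a x : Fin d → S} {b g : S}
    (hab : IsSystemOfParameters (params a b)) (hg : b ^ 2 + ∑ i, a i * x i = g)
    (hg0 : g ∈ nonZeroDivisors S) {i : ℕ} {z w : Finset (Fin d) → S}
    (hw : ∀ I, ¬ I.card < i + 1 → w I = 0)
    (hzw : ∀ I, I.card < i + 1 → (totalDiff a x b *ᵥ z) I = g * w I) :
    ∃ y : Finset (Fin d) → S, (∀ I, ¬ I.card < i + 3 → y I = 0) ∧
      ∀ I, I.card < i + 2 → (totalDiff a x b *ᵥ y) I = z I := by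
  have hlow : ∀ I : Finset (Fin d), I.card < i → (totalDiff a x b *ᵥ w) I = z I := by
    intro I hI
    refine mul_cancel_left_mem_nonZeroDivisors hg0 |>.1 ?_
    -- both `∂ (g w)` and `g z` are `∂ (∂ z)`
    have h1 := congrFun (totalDiff_mulVec_mulVec a x b hg z) I
    rw [totalDiff_mulVec_congr a x b (v := g • w) fun J hJ => hzw J (by omega), mulVec_smul] at h1
    exact h1
  -- above degree `i + 1`, where `v` is not controlled, it affects no boundary considered here
  let v : Finset (Fin d) → S := z - totalDiff a x b *ᵥ w
  have hv_low : ∀ I : Finset (Fin d), I.card < i → v I = 0 := fun I hI => by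
    simp [v, hlow I hI]
  have hv_cycle : ∀ I : Finset (Fin d), I.card < i + 1 → (totalDiff a x b *ᵥ v) I = 0 := by
    intro I hI
    simp [v, mulVec_sub, totalDiff_mulVec_mulVec a x b hg, hzw I hI]
  let z₁ : Finset (Fin d) → S := fun I => if I.card = i + 1 then v I else 0
  let z₀ : Finset (Fin d) → S := fun I => if I.card = i then v I else 0
  have hz₁ : ∀ I : Finset (Fin d), I.card ≠ i + 1 → z₁ I = 0 := fun I h => if_neg h
  have hz₀ : ∀ I : Finset (Fin d), I.card ≠ i → z₀ I = 0 := fun I h => if_neg h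
  have hv_eq : ∀ I : Finset (Fin d), I.card < i + 2 → v I = (z₁ + z₀) I := by
    intro I hI
    rcases lt_trichotomy I.card i with h | h | h
    · simp [z₁, z₀, hv_low I h, h.ne, (h.trans i.lt_succ_self).ne]
    · simp [z₁, z₀, h]
    · have h' : I.card = i + 1 := by omega
      simp [z₁, z₀, h']
  have hcyc : ∀ I : Finset (Fin d), I.card < i + 1 → (koszul a *ᵥ z₁) I + (koszul a *ᵥ z₀) I +
      ((signDiag d b *ᵥ z₁) I + (signDiag d b *ᵥ z₀) I) +
      (((koszul x)ᵀ *ᵥ z₁) I + ((koszul x)ᵀ *ᵥ z₀) I) = 0 := by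
    intro I hI
    have h1 := hv_cycle I hI
    rw [totalDiff_mulVec_congr a x b fun J hJ => hv_eq J (by omega)] at h1
    simp only [totalDiff, add_mulVec, mulVec_add, Pi.add_apply] at h1
    linear_combination h1
  obtain ⟨u₁, u₀, hu₁, hu₀, hb₁, hb₀⟩ := exists_koszul_cone_boundary hS hdim hab hz₁ hz₀
    (by
      funext I
      rw [Pi.add_apply, Pi.zero_apply, signDiag_mulVec]
      by_cases hI : I.card = i
      · have h1 := hcyc I (by omega)
        rw [koszul_mulVec_eq_zero a fun J hJ => hz₀ J (by omega),
          transpose_koszul_mulVec_eq_zero x fun J hJ => hz₁ J (by omega),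
          transpose_koszul_mulVec_eq_zero x fun J hJ => hz₀ J (by omega),
          signDiag_mulVec, signDiag_mulVec, hz₁ I (by omega)] at h1
        simpa using h1
      · rw [koszul_mulVec_eq_zero a fun J hJ => hz₁ J (by omega), hz₀ I hI]
        simp)
    (by
      funext I
      rw [Pi.zero_apply]
      by_cases hI : I.card + 1 = i
      · have h1 := hcyc I (by omega)
        rw [koszul_mulVec_eq_zero a fun J hJ => hz₁ J (by omega),
          transpose_koszul_mulVec_eq_zero x fun J hJ => hz₁ J (by omega),
          transpose_koszul_mulVec_eq_zero x fun J hJ => hz₀ J (by omega),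
          signDiag_mulVec, signDiag_mulVec, hz₁ I (by omega), hz₀ I (by omega)] at h1
        simpa using h1
      · exact koszul_mulVec_eq_zero a fun J hJ => hz₀ J (by omega))
  refine ⟨w + u₁ + u₀, fun I hI => ?_, fun I hI => ?_⟩
  · simp [hw I (by omega), hu₁ I (by omega), hu₀ I (by omega)]
  · have h1 := congrFun hb₁ I
    have h2 := congrFun hb₀ I
    rw [Pi.add_apply] at h1
    have h3 : z I = (totalDiff a x b *ᵥ w) I + (z₁ + z₀) I := by
      rw [← hv_eq I hI]; simp [v]
    rw [h3, Pi.add_apply, ← h1, ← h2, mulVec_add, mulVec_add, add_assoc, Pi.add_apply]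
    congr 1
    simp only [totalDiff, add_mulVec, Pi.add_apply]
    rw [transpose_koszul_mulVec_eq_zero x fun J hJ => hu₁ J (by omega),
      transpose_koszul_mulVec_eq_zero x fun J hJ => hu₀ J (by omega), signDiag_mulVec b u₁,
      hu₁ I (by omega)]
    ring

end Shamash

/-! ### The complex `F` over `S / (f)` and the matrix factorization -/

section Resolution

variable {S : Type*} [CommRing S] {d : ℕ}

theorem gdiff_mulVec (a x : Fin d → S) (b : S) {i : ℕ} (y : Finset (Fin d) → S) (I : Idx d i) :
    (gdiff a x b i *ᵥ fun J => y J.1) I = (totalDiff a x b *ᵥ y) I.1 := by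
  simp only [mulVec, dotProduct, gdiff_apply]
  rw [← Finset.sum_subtype (univ.filter fun J : Finset (Fin d) => J.card < i + 1) (by simp)
    fun J => totalDiff a x b I.1 J * y J]
  refine sum_subset (subset_univ _) fun J _ hJ => ?_
  have := I.2
  rw [totalDiff_eq_zero a x b (by simp at hJ; omega), zero_mul]

/-- The extension by zero of an element of `G_{i-1}` to `⨁ K_p`. -/
def extendZero {i : ℕ} (y : Idx d i → S) : Finset (Fin d) → S :=
  fun I => if h : I.card < i then y ⟨I, h⟩ else 0

theorem extendZero_val {i : ℕ} (y : Idx d i → S) (I : Idx d i) : extendZero y I.1 = y I :=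
  dif_pos I.2

theorem extendZero_of_not {i : ℕ} (y : Idx d i → S) {I : Finset (Fin d)} (h : ¬ I.card < i) :
    extendZero y I = 0 :=
  dif_neg h

theorem gdiff_mulVec_eq (a x : Fin d → S) (b : S) {i : ℕ} (y : Idx d (i + 1) → S) (I : Idx d i) :
    (gdiff a x b i *ᵥ y) I = (totalDiff a x b *ᵥ extendZero y) I.1 := by
  rw [← gdiff_mulVec]
  simp only [extendZero_val]

/-- `∂_i ∂_{i+1}` is `g` times the projection `G_{i+1} → G_{i-1}`. -/
theorem gdiff_mulVec_mulVec (a x : Fin d → S) (b : S) {g : S}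
    (hg : b ^ 2 + ∑ i, a i * x i = g) {i : ℕ} (y : Idx d (i + 2) → S) (I : Idx d i) :
    (gdiff a x b i *ᵥ gdiff a x b (i + 1) *ᵥ y) I =
      g * y ⟨I.1, I.2.trans (by omega)⟩ := by
  have h : gdiff a x b (i + 1) *ᵥ y = fun J => (totalDiff a x b *ᵥ extendZero y) J.1 :=
    funext fun J => gdiff_mulVec_eq a x b y J
  rw [h, gdiff_mulVec, totalDiff_mulVec_mulVec a x b hg, Pi.smul_apply, smul_eq_mul,
    ← extendZero_val y]

/-- A chain of `G_{i+1}` whose boundary vanishes modulo `f` is a boundary over `S`, not only modulo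
`f`, since `∂² = ε f`. -/
theorem exists_gdiff_boundary [IsLocalRing S] (hS : IsCohenMacaulayLocal S)
    (hdim : ringKrullDim S = d + 1) {f : S} (hf0 : f ∈ nonZeroDivisors S) {a x : Fin d → S} {b : S}
    {ε : Sˣ} (hab : IsSystemOfParameters (params a b)) (hrel : b ^ 2 + ∑ i, a i * x i = ε * f)
    {i : ℕ} {z : Idx d (i + 2) → S}
    (hz : ∀ I, (gdiff a x b (i + 1) *ᵥ z) I ∈ Ideal.span {f}) :
    ∃ y : Idx d (i + 3) → S, gdiff a x b (i + 2) *ᵥ y = z := by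
  choose w hw using fun I => Ideal.mem_span_singleton'.1 (hz I)
  obtain ⟨y, hy, hyz⟩ := exists_totalDiff_boundary hS hdim (x := x) (i := i) (z := extendZero z)
    (w := extendZero fun I => (ε⁻¹ : Sˣ) * w I) hab hrel
    (mul_mem ε.isUnit.mem_nonZeroDivisors hf0) (fun I hI => extendZero_of_not _ hI) (by
      intro I hI
      rw [← gdiff_mulVec_eq a x b z ⟨I, hI⟩, ← hw, extendZero, dif_pos hI]
      linear_combination (-(w ⟨I, hI⟩ * f)) * ε.mul_inv)
  refine ⟨fun J => y J.1, ?_⟩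
  funext I
  rw [gdiff_mulVec, hyz I.1 I.2, extendZero_val]

theorem mk_gdiff_mulVec (f : S) (a x : Fin d → S) (b : S) {i : ℕ} (y : Idx d (i + 1) → S) :
    gdiffBar f a x b i *ᵥ (Ideal.Quotient.mk (Ideal.span {f}) ∘ y) =
      Ideal.Quotient.mk (Ideal.span {f}) ∘ (gdiff a x b i *ᵥ y) :=
  (funext fun I => RingHom.map_mulVec _ _ _ I).symm

theorem koszul_mem {a : Fin d → S} {𝔞 : Ideal S} (ha : ∀ j, a j ∈ 𝔞) (I J : Finset (Fin d)) :
    koszul a I J ∈ 𝔞 := by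
  refine sum_mem fun j _ => ?_
  split_ifs
  · exact 𝔞.mul_mem_left _ (ha j)
  · exact 𝔞.zero_mem

theorem left_mem_span_params (a : Fin d → S) (b : S) (j : Fin d) :
    a j ∈ Ideal.span (Set.range (params a b)) :=
  Ideal.subset_span ⟨j.castSucc, by simp [params]⟩

theorem right_mem_span_params (a : Fin d → S) (b : S) :
    b ∈ Ideal.span (Set.range (params a b)) :=
  Ideal.subset_span ⟨Fin.last d, by simp [params]⟩

theorem gdiff_mem {a x : Fin d → S} {b : S}
    (hx : ∀ i, x i ∈ Ideal.span (Set.range (params a b))) {i : ℕ} (I : Idx d i)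
    (J : Idx d (i + 1)) : gdiff a x b i I J ∈ Ideal.span (Set.range (params a b)) := by
  refine add_mem (add_mem (koszul_mem (left_mem_span_params a b) _ _) ?_) (koszul_mem hx _ _)
  split_ifs
  · exact Ideal.mul_mem_left _ _ (right_mem_span_params a b)
  · exact Ideal.zero_mem _

theorem exists_gdiff_one_eq (a x : Fin d → S) (b : S) {s : S}
    (hs : s ∈ Ideal.span (Set.range (params a b))) :
    ∃ y : Idx d 2 → S, gdiff a x b 1 *ᵥ y = fun _ => s := by
  let φ : (Finset (Fin d) → S) →ₗ[S] S := LinearMap.proj ∅ ∘ₗ (totalDiff a x b).mulVecLin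
  have hφ : ∀ J, φ (Pi.single J 1) = totalDiff a x b ∅ J := fun J => by simp [φ]
  have hle : Ideal.span (Set.range (params a b)) ≤ LinearMap.range φ := by
    rw [span_range_params]
    refine sup_le (Ideal.span_le.2 ?_) (Ideal.span_le.2 ?_)
    · rintro _ ⟨j, rfl⟩
      refine ⟨Pi.single {j} 1, ?_⟩
      rw [hφ]
      simp [totalDiff, signDiag, koszul, (singleton_ne_empty j).symm, filter_singleton]
    · rintro _ rfl
      refine ⟨Pi.single ∅ 1, ?_⟩
      rw [hφ]
      simp [totalDiff, signDiag, koszul]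
  obtain ⟨y, rfl⟩ := hle hs
  refine ⟨fun J => y J.1, funext fun I => ?_⟩
  have hI : I.1 = ∅ := by have := I.2; rw [← card_eq_zero]; omega
  rw [gdiff_mulVec, hI]
  rfl

theorem gdiffBar_exact [IsLocalRing S] (hS : IsCohenMacaulayLocal S)
    (hdim : ringKrullDim S = d + 1) {f : S} (hf0 : f ∈ nonZeroDivisors S) {a x : Fin d → S} {b : S}
    {ε : Sˣ} (hab : IsSystemOfParameters (params a b)) (hrel : b ^ 2 + ∑ i, a i * x i = ε * f)
    (i : ℕ) :
    Function.Exact (gdiffBar f a x b (i + 2)).mulVecLin (gdiffBar f a x b (i + 1)).mulVecLin := by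
  intro z
  simp only [mulVecLin_apply, Set.mem_range]
  constructor
  · obtain ⟨z, rfl⟩ := Ideal.Quotient.mk_surjective.comp_left z
    intro hz
    rw [mk_gdiff_mulVec] at hz
    obtain ⟨y, rfl⟩ := exists_gdiff_boundary hS hdim hf0 hab hrel
      fun I => Ideal.Quotient.eq_zero_iff_mem.1 (congrFun hz I)
    exact ⟨_, mk_gdiff_mulVec f a x b y⟩
  · rintro ⟨y, rfl⟩
    obtain ⟨y, rfl⟩ := Ideal.Quotient.mk_surjective.comp_left y
    rw [mk_gdiff_mulVec, mk_gdiff_mulVec]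
    funext I
    rw [Function.comp_apply, gdiff_mulVec_mulVec a x b hrel]
    exact Ideal.Quotient.eq_zero_iff_mem.2
      (Ideal.mul_mem_right _ _ (Ideal.mul_mem_left _ _ (Ideal.mem_span_singleton_self f)))

theorem gdiffBar_isMinimalFreeResolution [IsLocalRing S] (hS : IsCohenMacaulayLocal S)
    (hdim : ringKrullDim S = d + 1) {f : S} (hf : f ∈ IsLocalRing.maximalIdeal S)
    (hf0 : f ∈ nonZeroDivisors S) {a x : Fin d → S} {b : S}
    {ε : Sˣ} (hab : IsSystemOfParameters (params a b))
    (hx : ∀ i, x i ∈ Ideal.span (Set.range (params a b)))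
    (hrel : b ^ 2 + ∑ i, a i * x i = ε * f) :
    IsMinimalFreeResolution (ι := fun i => Idx d (i + 1)) (fun i => gdiffBar f a x b (i + 1))
      (augmentation d (ulrichIdeal f a b)) where
  surjective := (Submodule.mkQ_surjective _).comp (LinearMap.proj_surjective _)
  exact_zero := by
    intro z
    have hval : ∀ I : Idx d 1, I = ⟨∅, by simp⟩ := fun I =>
      Subtype.ext (by have := I.2; rw [← card_eq_zero]; omega)
    have haug : augmentation d (ulrichIdeal f a b) z = 0 ↔
        z ⟨∅, by simp⟩ ∈ ulrichIdeal f a b := by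
      rw [augmentation, LinearMap.comp_apply, Submodule.mkQ_apply, Submodule.Quotient.mk_eq_zero]
      rfl
    rw [haug, ulrichIdeal, Ideal.mem_map_iff_of_surjective _ Ideal.Quotient.mk_surjective]
    constructor
    · rintro ⟨s, hs, hsz⟩
      obtain ⟨y, hy⟩ := exists_gdiff_one_eq a x b hs
      refine ⟨Ideal.Quotient.mk _ ∘ y, ?_⟩
      rw [mulVecLin_apply, mk_gdiff_mulVec, hy]
      funext I
      rw [hval I]
      exact hsz
    · rintro ⟨y, rfl⟩
      obtain ⟨y, rfl⟩ := Ideal.Quotient.mk_surjective.comp_left y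
      rw [mulVecLin_apply, mk_gdiff_mulVec]
      refine ⟨(gdiff a x b 1 *ᵥ y) ⟨∅, by simp⟩, ?_, rfl⟩
      rw [mulVec, dotProduct]
      exact sum_mem fun J _ => Ideal.mul_mem_right _ _ (gdiff_mem hx _ J)
  exact_succ := gdiffBar_exact hS hdim hf0 hab hrel
  minimal := by
    intro i I J
    have hle : Ideal.span (Set.range (params a b)) ≤ IsLocalRing.maximalIdeal S :=
      Ideal.span_le.2 (Set.range_subset_iff.2 hab.mem)
    have hmem := hle (gdiff_mem hx I J)
    intro hunit
    obtain ⟨t, ht⟩ := hunit.exists_right_inv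
    obtain ⟨t, rfl⟩ := Ideal.Quotient.mk_surjective t
    have h1 : gdiff a x b (i + 1) I J * t - 1 ∈ Ideal.span {f} := Ideal.Quotient.eq.1 ht
    have h2 := (Ideal.span_singleton_le_iff_mem _).2 hf h1
    refine (IsLocalRing.maximalIdeal.isMaximal S).ne_top ((Ideal.eq_top_iff_one _).2 ?_)
    simpa using sub_mem (Ideal.mul_mem_right t _ hmem) h2

/-- Every subset of `Fin d` has at most `d` elements, so that `G_d` is all of `⨁ K_p`. -/
def idxEquiv (d : ℕ) : Idx d (d + 1) ≃ Finset (Fin d) :=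
  Equiv.subtypeUnivEquiv fun I => Nat.lt_succ_of_le (by simpa using card_le_univ I)

theorem card_idx (d : ℕ) : Fintype.card (Idx d (d + 1)) = 2 ^ d := by
  rw [Fintype.card_congr (idxEquiv d)]
  simp

theorem topSquare_eq (a x : Fin d → S) (b : S) :
    topSquare a x b = (totalDiff a x b).submatrix (idxEquiv d) (idxEquiv d) := by
  ext I J
  exact gdiff_apply a x b (d + 1) I (topEquiv d J)

theorem topSquare_mul_self (a x : Fin d → S) (b : S) :
    topSquare a x b * topSquare a x b = (b ^ 2 + ∑ i, a i * x i) • 1 := by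
  rw [topSquare_eq, submatrix_mul_equiv, totalDiff_mul_self, ← submatrix_one_equiv (idxEquiv d)]
  rfl

theorem topSquare_mulVec (a x : Fin d → S) (b : S) (y : Idx d (d + 2) → S) :
    topSquare a x b *ᵥ (y ∘ topEquiv d) = gdiff a x b (d + 1) *ᵥ y := by
  rw [topSquare, submatrix_mulVec_equiv]
  simp [Function.comp_assoc]

theorem tau_eq_zero_iff (f : S) (a x : Fin d → S) (b : S) (z : Idx d (d + 1) → S) :
    tau f a x b z = 0 ↔ ∀ I, (gdiff a x b d *ᵥ z) I ∈ Ideal.span {f} := by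
  have h : ((tau f a x b z : syzygyModule f a x b) : Idx d d → S ⧸ Ideal.span {f}) =
      gdiffBar f a x b d *ᵥ (Ideal.Quotient.mk (Ideal.span {f}) ∘ z) := rfl
  rw [← Submodule.coe_eq_zero, h, mk_gdiff_mulVec, funext_iff]
  simp only [Function.comp_apply, Pi.zero_apply, Ideal.Quotient.eq_zero_iff_mem]

theorem tau_surjective (f : S) (a x : Fin d → S) (b : S) :
    Function.Surjective (tau f a x b) :=
  (LinearMap.surjective_rangeRestrict _).comp Ideal.Quotient.mk_surjective.comp_left

/-- The sequence `0 → G_{d+1} → G_d → M → 0` is exact. -/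
theorem topSquare_isShortExact [IsLocalRing S] (hS : IsCohenMacaulayLocal S) (hd : 1 ≤ d)
    (hdim : ringKrullDim S = d + 1) {f : S} (hf0 : f ∈ nonZeroDivisors S) {a x : Fin d → S} {b : S}
    {ε : Sˣ} (hab : IsSystemOfParameters (params a b))
    (hrel : b ^ 2 + ∑ i, a i * x i = ε * f) :
    IsShortExact (gdiff a x b (d + 1)).mulVecLin (tau f a x b) where
  injective := by
    rw [injective_iff_map_eq_zero]
    intro y hy
    rw [mulVecLin_apply, ← topSquare_mulVec] at hy
    have h1 := congrArg (topSquare a x b *ᵥ ·) hy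
    simp only [mulVec_mulVec, topSquare_mul_self, hrel, smul_mulVec, one_mulVec, mulVec_zero] at h1
    funext J
    have h2 := congrFun h1 ((topEquiv d).symm J)
    simp only [Pi.smul_apply, Function.comp_apply, Equiv.apply_symm_apply] at h2
    exact (mul_left_mem_nonZeroDivisors_eq_zero_iff
      (mul_mem ε.isUnit.mem_nonZeroDivisors hf0)).1 h2
  exact := by
    intro z
    rw [tau_eq_zero_iff]
    constructor
    -- for `d = 0` the module `M` would vanish
    · obtain ⟨d, rfl⟩ := Nat.exists_eq_add_of_le' hd
      exact fun hz => exists_gdiff_boundary hS hdim hf0 hab hrel hz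
    · rintro ⟨y, rfl⟩ I
      rw [mulVecLin_apply, gdiff_mulVec_mulVec a x b hrel]
      exact Ideal.mul_mem_right _ _ (Ideal.mul_mem_left _ _ (Ideal.mem_span_singleton_self f))
  surjective := tau_surjective f a x b

theorem IsShortExact.topSquare {M : Type*} [AddCommGroup M] [Module S M] {a x : Fin d → S} {b : S}
    {π : (Idx d (d + 1) → S) →ₗ[S] M} (h : IsShortExact (gdiff a x b (d + 1)).mulVecLin π) :
    IsShortExact (topSquare a x b).mulVecLin π := by
  have hcomp : (UlrichMF.topSquare a x b).mulVecLin =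
      (gdiff a x b (d + 1)).mulVecLin ∘ₗ
        (LinearEquiv.funCongrLeft S S (topEquiv d).symm).toLinearMap := by
    refine LinearMap.ext fun y => ?_
    change _ = gdiff a x b (d + 1) *ᵥ (y ∘ (topEquiv d).symm)
    rw [← topSquare_mulVec]
    simp [Function.comp_assoc]
  refine ⟨?_, ?_, h.surjective⟩
  · rw [hcomp]
    exact h.injective.comp (LinearEquiv.injective _)
  · intro z
    rw [h.exact z, hcomp, LinearMap.coe_comp, LinearEquiv.coe_coe,
      (LinearEquiv.surjective _).range_comp]

end Resolution

end UlrichMF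

open UlrichMF in
theorem corollary3p5 {S : Type*} [CommRing S] [IsLocalRing S] (hS : IsCohenMacaulayLocal S)
    (d : ℕ) (hd : 1 ≤ d) (hdim : ringKrullDim S = d + 1)
    (f : S) (hf : f ∈ IsLocalRing.maximalIdeal S) (hf0 : f ∈ nonZeroDivisors S)
    (a x : Fin d → S) (b : S) (ε : Sˣ)
    (hab : IsSystemOfParameters (params a b))
    (hx : ∀ i, x i ∈ Ideal.span (Set.range (params a b)))
    (hrel : b ^ 2 + ∑ i, a i * x i = ε * f) :
    -- `∂ ⊗ R` is a minimal free resolution of `R / I`, so that `M = Im (∂_d ⊗ R)` is the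
    -- `d`-th syzygy module of `R / I`
    IsMinimalFreeResolution (ι := fun i => Idx d (i + 1)) (fun i => gdiffBar f a x b (i + 1))
      (augmentation d (ulrichIdeal f a b)) ∧
    -- `0 → G_{d+1} → G_d → M → 0` is exact over `S`
    IsShortExact (gdiff a x b (d + 1)).mulVecLin (tau f a x b) ∧
    -- `∂_{d+1}` is a square matrix of size `2 ^ d` whose square is `ε f E`
    Fintype.card (Idx d (d + 1)) = 2 ^ d ∧
    topSquare a x b * topSquare a x b = ((ε : S) * f) • (1 : Matrix _ _ S) ∧
    -- `∂_{d+1}` gives a matrix factorization of `M`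
    IsMatrixFactorization ((ε : S) * f) (topSquare a x b) (topSquare a x b)
      (syzygyModule f a x b) ∧
    IsMatrixFactorization f (topSquare a x b) (((ε⁻¹ : Sˣ) : S) • topSquare a x b)
      (syzygyModule f a x b) := by
  have hexact := topSquare_isShortExact hS hd hdim hf0 hab hrel
  have hsq := topSquare_mul_self a x b
  rw [hrel] at hsq
  have hsq' : topSquare a x b * (((ε⁻¹ : Sˣ) : S) • topSquare a x b) =
      f • (1 : Matrix _ _ S) := by
    rw [Matrix.mul_smul, hsq, smul_smul, Units.inv_mul_cancel_left]
  exact ⟨gdiffBar_isMinimalFreeResolution hS hdim hf hf0 hab hx hrel, hexact, card_idx d, hsq,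
    ⟨hsq, hsq, _, hexact.topSquare⟩,
    ⟨hsq', by rw [Matrix.smul_mul, ← Matrix.mul_smul, hsq'], _, hexact.topSquare⟩⟩
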